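/- Let $f(x)=x+\sum_{n\ge 2}a_nx^n\in\mathbb{C}[[x]]$ be a formal power series. (a) There is a unique sequence $(b_j)_{j\ge1}$ of complex numbers with $$f(x)=\cdots\exp\Big(b_3x^4\tfrac{d}{dx}\Big)\exp\Big(b_2x^3\tfrac{d}{dx}\Big)\exp\Big(b_1x^2\tfrac{d}{dx}\Big)\cdot x,$$ where the infinite product is taken coefficientwise: each coefficient of the product of the rightmost $N$ factors applied to $x$ is constant for all large $N$. (b) There is a unique sequence $(A_j)_{j\ge1}$ of complex numbers with $$f(x)=\exp\Big(\sum_{j\ge1}A_jx^{j+1}\tfrac{d}{dx}\Big)\cdot x.$$ (c) Let $V$ be a vertex operator algebra over $\mathbb{C}$ (a $\mathbb{Z}$-graded vector space with finite-dimensional weight spaces, zero in all sufficiently negative weights, with vertex operators $Y(u,x)=\sum_{n\in\mathbb{Z}}u_nx^{-n-1}$, vacuum $\mathbf 1$ and conformal vector $\omega$ that satisfy truncation, the vacuum and creation properties, the Jacobi identity, the Virasoro relations for $L(n)=\omega_{n+1}$ with some central charge, $L(0)v=nv$ for $v$ of weight $n$, and $Y(L(-1)v,x)=\frac{d}{dx}Y(v,x)$).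 With $b_j$ and $A_j$ as in (a) and (b), each $L(j)$, $j\ge1$, and $\sum_{j\ge1}A_jL(j)$ (a finite sum on each vector) are locally nilpotent, so that their exponentials are defined. For each $v\in V$ the vectors $\exp(-b_NL(N))\cdots\exp(-b_1L(1))v$ are constant for all large $N$, and the resulting map $$\widetilde\varphi_f=\cdots\exp(-b_3L(3))\exp(-b_2L(2))\exp(-b_1L(1))$$ and the map $$\varphi_f=\exp\Big(-\sum_{j\ge1}A_jL(j)\Big)$$ are linear automorphisms of $V$, and $\widetilde\varphi_f=\varphi_f$. -/

import Mathlib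

open Filter PowerSeries
open scoped Nat VertexOperator

noncomputable section

/-- A vertex operator algebra structure on the complex vector space `V`. For `u : V` the vertex
operator is `Y(u, x) = ∑ n, u_n x^(-n-1)`, where `u_n = VertexOperator.ncoeff (Y u) n`; that each
`Y(u, x) v` is a Laurent series with finitely many negative powers of `x` is part of the type of
`Y`. -/
structure VertexOperatorAlgebra (V : Type*) [AddCommGroup V] [Module ℂ V] where
  /-- the space of vectors of conformal weight `n` -/
  weightSpace : ℤ → Submodule ℂ V
  isInternal : DirectSum.IsInternal weightSpace
  finiteDimensional : ∀ n, FiniteDimensional ℂ (weightSpace n)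
  bounded_below : ∃ N : ℤ, ∀ n < N, weightSpace n = ⊥
  /-- the vertex operator map -/
  Y : V →ₗ[ℂ] VertexOperator ℂ V
  /-- the vacuum vector -/
  vacuum : V
  vacuum_mem : vacuum ∈ weightSpace 0
  /-- the conformal vector -/
  conformal : V
  conformal_mem : conformal ∈ weightSpace 2
  /-- the central charge -/
  centralCharge : ℂ
  /-- `Y(𝟏, x) = id` -/
  vacuum_apply : ∀ (n : ℤ) (v : V),
    VertexOperator.ncoeff (Y vacuum) n v = if n = -1 then v else 0
  /-- `Y(v, x) 𝟏` has no negative powers of `x` -/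
  creation : ∀ (v : V) (n : ℤ), 0 ≤ n → VertexOperator.ncoeff (Y v) n vacuum = 0
  /-- the constant term of `Y(v, x) 𝟏` is `v` -/
  creation_const : ∀ v : V, VertexOperator.ncoeff (Y v) (-1) vacuum = v
  /-- The Jacobi identity
  `x₀⁻¹ δ((x₁ - x₂)/x₀) Y(u, x₁) Y(v, x₂) - x₀⁻¹ δ((-x₂ + x₁)/x₀) Y(v, x₂) Y(u, x₁)
    = x₂⁻¹ δ((x₁ - x₀)/x₂) Y(Y(u, x₀) v, x₂)`,
  in terms of the coefficients of `x₀^(-l-1) x₁^(-m-1) x₂^(-n-1)`. By truncation, all sums are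
  finite. -/
  jacobi : ∀ (u v w : V) (l m n : ℤ),
    (∑ᶠ i : ℕ, ((-1 : ℂ) ^ i * ((Ring.choose l i : ℤ) : ℂ)) •
        VertexOperator.ncoeff (Y u) (m + l - i) (VertexOperator.ncoeff (Y v) (n + i) w)) -
      (∑ᶠ i : ℕ, ((-1 : ℂ) ^ (l + i) * ((Ring.choose l i : ℤ) : ℂ)) •
        VertexOperator.ncoeff (Y v) (n + l - i) (VertexOperator.ncoeff (Y u) (m + i) w)) =
    ∑ᶠ i : ℕ, ((Ring.choose m i : ℤ) : ℂ) •
      VertexOperator.ncoeff (Y (VertexOperator.ncoeff (Y u) (l + i) v)) (m + n - i) w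
  /-- the Virasoro relations for `L(n) = ω_(n+1)` -/
  virasoro : ∀ m n : ℤ,
    ⁅(VertexOperator.ncoeff (Y conformal) (m + 1) : Module.End ℂ V),
      (VertexOperator.ncoeff (Y conformal) (n + 1) : Module.End ℂ V)⁆ =
      ((m : ℂ) - n) • VertexOperator.ncoeff (Y conformal) (m + n + 1) +
        (if m + n = 0 then ((m : ℂ) ^ 3 - m) / 12 * centralCharge else 0) •
          (1 : Module.End ℂ V)
  /-- `L(0) v = n v` for `v` of conformal weight `n` -/
  weight_apply : ∀ (n : ℤ), ∀ v ∈ weightSpace n,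
    VertexOperator.ncoeff (Y conformal) 1 v = (n : ℂ) • v
  /-- `Y(L(-1) v, x) = d/dx Y(v, x)` -/
  derivative_apply : ∀ (v : V) (n : ℤ),
    VertexOperator.ncoeff (Y (VertexOperator.ncoeff (Y conformal) 0 v)) n =
      (-n : ℂ) • VertexOperator.ncoeff (Y v) (n - 1)

/-- The composite `E N ∘ ⋯ ∘ E 2 ∘ E 1` of the first `N` factors of the infinite product
`⋯ E 3 ∘ E 2 ∘ E 1`. -/
def partialProduct {M : Type*} (E : ℕ+ → M → M) : ℕ → M → M
  | 0 => id
  | N + 1 => E N.succPNat ∘ partialProduct E N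

/-- `T` is locally nilpotent: each vector is killed by some power of `T`. -/
def IsLocallyNilpotent {V : Type*} [AddCommGroup V] [Module ℂ V] (T : Module.End ℂ V) : Prop :=
  ∀ v, ∃ n : ℕ, (T ^ n) v = 0

/-- `exp(T) v = ∑ n, T ^ n v / n!`, for locally nilpotent `T`, so that the sum is finite. -/
def expEnd {V : Type*} [AddCommGroup V] [Module ℂ V] (T : Module.End ℂ V) (v : V) : V :=
  ∑ᶠ n : ℕ, ((n ! : ℂ)⁻¹) • (T ^ n) v

namespace VertexOperatorAlgebra

variable {V : Type*} [AddCommGroup V] [Module ℂ V] (𝒱 : VertexOperatorAlgebra V)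

/-- The Virasoro operator `L(n) = ω_(n+1)`. -/
def L (n : ℤ) : Module.End ℂ V := VertexOperator.ncoeff (𝒱.Y 𝒱.conformal) (n + 1)

/-- For each `v`, `L(j) v = 0` for all but finitely many `j ≥ 1`. -/
theorem finite_support_L (A : ℕ+ → ℂ) (v : V) :
    (Function.support fun j : ℕ+ => A j • 𝒱.L j v).Finite := by
  set d := HahnSeries.order ((HahnModule.of ℂ).symm (𝒱.Y 𝒱.conformal v)) with hd
  refine (Set.finite_Iic (Nat.succPNat d.natAbs)).subset fun j hj => ?_
  by_contra hlt
  apply hj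
  have h1 : d.natAbs + 1 < (j : ℕ) := by
    have h3 : Nat.succPNat d.natAbs < j := not_le.mp hlt
    exact PNat.coe_lt_coe _ _ |>.mpr h3
  have h2 : 𝒱.L j v = 0 := by
    apply VertexOperator.ncoeff_eq_zero_of_lt_order
    rw [← hd]
    omega
  change A j • 𝒱.L j v = 0
  rw [h2, smul_zero]

/-- The operator `∑ j ≥ 1, A j L(j)`, which is a finite sum on each vector. -/
def sumL (A : ℕ+ → ℂ) : Module.End ℂ V where
  toFun v := ∑ᶠ j : ℕ+, A j • 𝒱.L j v
  map_add' v w := by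
    rw [← finsum_add_distrib (𝒱.finite_support_L A v) (𝒱.finite_support_L A w)]
    simp
  map_smul' c v := by
    rw [RingHom.id_apply, smul_finsum' c (𝒱.finite_support_L A v)]
    simp [smul_comm c]

end VertexOperatorAlgebra

/-- The derivation `g(x) d/dx` of `ℂ[[x]]`. -/
def vectorField (g : ℂ⟦X⟧) : Derivation ℂ ℂ⟦X⟧ ℂ⟦X⟧ := g • PowerSeries.derivative ℂ

/-- The power series `∑ j ≥ 1, A j x^(j+1)`. -/
def coeffSeries (A : ℕ+ → ℂ) : ℂ⟦X⟧ :=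
  PowerSeries.mk fun n => if h : 2 ≤ n then A ⟨n - 1, by omega⟩ else 0

/-- `exp(D) g = ∑ n, D ^ n g / n!`, computed coefficient by coefficient, for a derivation `D` of
`ℂ[[x]]` that strictly increases degrees, so that the sum is finite in each degree. -/
def expDerivation (D : Derivation ℂ ℂ⟦X⟧ ℂ⟦X⟧) (g : ℂ⟦X⟧) : ℂ⟦X⟧ :=
  PowerSeries.mk fun d => ∑ᶠ n : ℕ, ((n ! : ℂ)⁻¹) * coeff d (D^[n] g)

/-- `f(x) = exp(∑ j ≥ 1, A j x^(j+1) d/dx) · x`. -/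
def IsExponentialForm (f : ℂ⟦X⟧) (A : ℕ+ → ℂ) : Prop :=
  expDerivation (vectorField (coeffSeries A)) X = f

/-- `f(x) = ⋯ exp(b 3 x^4 d/dx) exp(b 2 x^3 d/dx) exp(b 1 x^2 d/dx) · x`: each coefficient of the
finite partial products is eventually equal to that of `f`. -/
def IsProductDecomposition (f : ℂ⟦X⟧) (b : ℕ+ → ℂ) : Prop :=
  ∀ d : ℕ, ∀ᶠ N : ℕ in atTop,
    coeff d (partialProduct
      (fun j : ℕ+ => expDerivation (b j • vectorField (X ^ ((j : ℕ) + 1)))) N X) = coeff d f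

end

/-! Write a field as g(x)·x d/dx, so that x^j matches the operator -L(j), and let ρ(h) = ∑ h_j L(j).
No Baker–Campbell–Hausdorff formula is needed: the two automorphisms are compared through what they
do to the grading operator L(0).

On the series side, exp(g·x d/dx) carries h·x d/dx to (exp(ad g)h)·x d/dx
(`expSeries_mul_eulerDerivation`). Applying this to the trivial identity x = 1·x·(dx/dx) shows that
the transform h of the Euler field satisfies f = h·x f'. Hence h = f/(x f') depends on f alone, not
on the way f is written as a product or an exponential (`eventually_X_pow_dvd_prodAd_sub`).

On V the same conjugation gives exp(-ρ(g)) L(0) = ρ(exp(ad g)1) exp(-ρ(g)) (`expEnd_fieldRep`). For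
v of weight n, both candidate images of v are then eigenvectors of ρ(h) with eigenvalue n, and both
are v plus terms of lower weight. Their difference lies in lower weights, where ρ(h) = L(0) +
(weight-lowering terms) cannot have eigenvalue n, so it vanishes (`eq_zero_of_fieldRep_eq_smul`).

Existence and uniqueness of b and A come from solving triangular systems coefficient by coefficient.
-/

/-! ### Truncated exponentials and bilinear maps. -/

section Exponential

variable {M M₁ M₂ M₃ N : Type*} [AddCommGroup M] [Module ℂ M] [AddCommGroup M₁] [Module ℂ M₁]
  [AddCommGroup M₂] [Module ℂ M₂] [AddCommGroup M₃] [Module ℂ M₃] [AddCommGroup N] [Module ℂ N]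

/-- The truncated exponential `∑ n < K, T ^ n / n!`. -/
noncomputable def expTrunc (K : ℕ) (T : Module.End ℂ M) : Module.End ℂ M :=
  ∑ n ∈ Finset.range K, ((n ! : ℂ)⁻¹) • T ^ n

theorem expTrunc_apply (K : ℕ) (T : Module.End ℂ M) (v : M) :
    expTrunc K T v = ∑ n ∈ Finset.range K, ((n ! : ℂ)⁻¹) • (T ^ n) v := by
  simp [expTrunc]

/-- The Leibniz rule for a bilinear map with respect to which three operators act like a
derivation. -/
theorem leibniz_pow_bilinear (B : M₁ →ₗ[ℂ] M₂ →ₗ[ℂ] M₃) {D₁ : Module.End ℂ M₁}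
    {D₂ : Module.End ℂ M₂} {D₃ : Module.End ℂ M₃}
    (hB : ∀ x y, D₃ (B x y) = B (D₁ x) y + B x (D₂ y)) (n : ℕ) (x : M₁) (y : M₂) :
    (D₃ ^ n) (B x y) = ∑ p ∈ Finset.HasAntidiagonal.antidiagonal n,
      n.choose p.1 • B ((D₁ ^ p.1) x) ((D₂ ^ p.2) y) := by
  -- On the tensor product the Leibniz rule becomes the binomial theorem for the commuting operators
  -- D₁ ⊗ 1 and 1 ⊗ D₂.
  set P : Module.End ℂ (TensorProduct ℂ M₁ M₂) := TensorProduct.map D₁ 1 with hP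
  set Q : Module.End ℂ (TensorProduct ℂ M₁ M₂) := TensorProduct.map 1 D₂ with hQ
  have hPn : ∀ i, P ^ i = TensorProduct.map (D₁ ^ i) 1 := fun i => by
    rw [hP, TensorProduct.map_pow, one_pow]
  have hQn : ∀ i, Q ^ i = TensorProduct.map 1 (D₂ ^ i) := fun i => by
    rw [hQ, TensorProduct.map_pow, one_pow]
  have hPQ : Commute P Q := by
    rw [commute_iff_eq, hP, hQ, ← TensorProduct.map_mul, ← TensorProduct.map_mul]
    simp
  have h1 : ∀ t, D₃ (TensorProduct.lift B t) = TensorProduct.lift B ((P + Q) t) := by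
    intro t
    induction t using TensorProduct.induction_on with
    | zero => simp
    | tmul x y => simp [hP, hQ, hB]
    | add a b ha hb => rw [map_add, map_add, ha, hb, map_add, map_add]
  have h2 : ∀ t, (D₃ ^ n) (TensorProduct.lift B t) = TensorProduct.lift B (((P + Q) ^ n) t) := by
    induction n with
    | zero => simp
    | succ n ih =>
      intro t
      rw [pow_succ, Module.End.mul_apply, h1, ih, pow_succ, Module.End.mul_apply]
  have h3 := h2 (x ⊗ₜ[ℂ] y)
  rw [TensorProduct.lift.tmul] at h3
  rw [h3, hPQ.add_pow']
  simp [hPn, hQn]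

theorem sum_range_antidiagonal_eq {R : Type*} [AddCommMonoid R] (a : ℕ → ℕ → R) (K : ℕ) (ha : ∀ i j, K ≤ i + j → a i j = 0) :
    ∑ n ∈ Finset.range K, ∑ p ∈ Finset.HasAntidiagonal.antidiagonal n, a p.1 p.2 =
      ∑ i ∈ Finset.range K, ∑ j ∈ Finset.range K, a i j := by
  rw [← Finset.sum_product', ← Finset.sum_filter_of_ne (p := fun p : ℕ × ℕ => p.1 + p.2 < K)
      (fun p _ hp => by
        by_contra h
        exact hp (ha _ _ (not_lt.mp h))),
    ← Finset.sum_fiberwise_of_maps_to (t := Finset.range K) (g := fun p : ℕ × ℕ => p.1 + p.2)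
      (fun p hp => by simpa using (Finset.mem_filter.mp hp).2)]
  refine Finset.sum_congr rfl fun n hn => Finset.sum_congr ?_ fun _ _ => rfl
  ext ⟨i, j⟩
  simp only [Finset.mem_range] at hn
  simp only [Finset.HasAntidiagonal.mem_antidiagonal, Finset.mem_filter, Finset.mem_product, Finset.mem_range]
  omega

/-- Exponentiating the Leibniz rule, since binom(i+j, i)/(i+j)! = 1/(i! j!). The map l serves to
kill the terms with i + j ≥ K, where triangular and square truncation differ; it is a coefficient
map for power series and the identity on V. -/
theorem expTrunc_bilinear (B : M₁ →ₗ[ℂ] M₂ →ₗ[ℂ] M₃) {D₁ : Module.End ℂ M₁}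
    {D₂ : Module.End ℂ M₂} {D₃ : Module.End ℂ M₃}
    (hB : ∀ x y, D₃ (B x y) = B (D₁ x) y + B x (D₂ y)) (l : M₃ →ₗ[ℂ] N) (K : ℕ) (x : M₁) (y : M₂)
    (hl : ∀ i j, K ≤ i + j → l (B ((D₁ ^ i) x) ((D₂ ^ j) y)) = 0) :
    l (expTrunc K D₃ (B x y)) = l (B (expTrunc K D₁ x) (expTrunc K D₂ y)) := by
  have h := sum_range_antidiagonal_eq
    (fun i j => ((i ! : ℂ)⁻¹) • ((j ! : ℂ)⁻¹) • l (B ((D₁ ^ i) x) ((D₂ ^ j) y))) K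
    (fun i j hij => by simp [hl i j hij])
  simp only [expTrunc_apply, map_sum, map_smul, LinearMap.sum_apply, LinearMap.smul_apply]
  have h' : ∑ j ∈ Finset.range K, ((j ! : ℂ)⁻¹) • ∑ i ∈ Finset.range K, ((i ! : ℂ)⁻¹) •
      l (B ((D₁ ^ i) x) ((D₂ ^ j) y)) = ∑ i ∈ Finset.range K, ∑ j ∈ Finset.range K,
        ((i ! : ℂ)⁻¹) • ((j ! : ℂ)⁻¹) • l (B ((D₁ ^ i) x) ((D₂ ^ j) y)) := by
    simp only [Finset.smul_sum]
    rw [Finset.sum_comm]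
    exact Finset.sum_congr rfl fun i _ => Finset.sum_congr rfl fun j _ => smul_comm _ _ _
  rw [h', ← h]
  refine Finset.sum_congr rfl fun n _ => ?_
  rw [leibniz_pow_bilinear B hB, map_sum, Finset.smul_sum]
  refine Finset.sum_congr rfl fun p hp => ?_
  obtain rfl := Finset.HasAntidiagonal.mem_antidiagonal.mp hp
  rw [map_nsmul, ← Nat.cast_smul_eq_nsmul ℂ, smul_smul, smul_smul, Nat.cast_add_choose]
  congr 1
  have h1 : ((p.1 + p.2)! : ℂ) ≠ 0 := Nat.cast_ne_zero.mpr (Nat.factorial_ne_zero _)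
  have h2 : (p.1 ! : ℂ) ≠ 0 := Nat.cast_ne_zero.mpr (Nat.factorial_ne_zero _)
  have h3 : (p.2 ! : ℂ) ≠ 0 := Nat.cast_ne_zero.mpr (Nat.factorial_ne_zero _)
  field_simp

end Exponential

/-! ### Triangular systems of equations. -/

/-- A map on sequences that is unitriangular, in that its `n`-th entry is `A n` up to a function of
the earlier entries, is bijective. -/
theorem existsUnique_of_unitriangular (G : (ℕ+ → ℂ) → ℕ+ → ℂ)
    (hG : ∀ A A' n, (∀ j < n, A j = A' j) → G A n - G A' n = A n - A' n) (c : ℕ+ → ℂ) :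
    ∃! A, G A = c := by
  classical
  have hex : ∀ n : ℕ, ∃ A : ℕ+ → ℂ, ∀ j : ℕ+, (j : ℕ) ≤ n → G A j = c j := by
    intro n
    induction n with
    | zero => exact ⟨0, fun j hj => absurd j.pos (by omega)⟩
    | succ n ih =>
      obtain ⟨A, hA⟩ := ih
      set m := n.succPNat
      -- Changing entry m shifts the m-th value of `G` by the same amount, so the defect is added to
      -- that entry.
      refine ⟨Function.update A m (A m + (c m - G A m)), fun j hj => ?_⟩
      have h := hG (Function.update A m (A m + (c m - G A m))) A j fun i hi =>
        Function.update_of_ne (fun h => by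
          have h1 : (i : ℕ) = n + 1 := by rw [h]; rfl
          have h2 : (i : ℕ) < j := hi
          omega) _ _
      rcases eq_or_ne j m with rfl | hjm
      · rw [Function.update_self] at h
        linear_combination h
      · rw [Function.update_of_ne hjm, sub_self, sub_eq_zero] at h
        rw [h, hA j]
        have : (j : ℕ) ≠ n + 1 := fun h => hjm (PNat.eq h)
        omega
  have huniq : ∀ A A' (n : ℕ+), (∀ j ≤ n, G A j = G A' j) → A n = A' n := by
    intro A A' n
    induction n using PNat.strongInductionOn with
    | _ n ih =>
      intro h
      have := hG A A' n fun j hj => ih j hj fun i hi => h i (hi.trans hj.le)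
      rw [h n le_rfl, sub_self] at this
      exact (sub_eq_zero.mp this.symm)
  choose S hS using hex
  -- The diagonal of the finite solutions: by uniqueness on initial segments they agree where they
  -- overlap.
  refine ⟨fun n => S n n, funext fun n => ?_, fun A hA => funext fun n => huniq _ _ n fun j hj => ?_⟩
  · have hagree : ∀ j ≤ n, S j j = S n j := fun j hj => huniq _ _ j fun i hi => by
      rw [hS j i hi, hS n i (hi.trans hj)]
    have := hG (fun n => S n n) (S n) n fun j hj => hagree j hj.le
    rw [sub_self, sub_eq_zero] at this
    rw [this, hS n n le_rfl]
  · rw [hA, hS n j hj]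

/-! ### Exponentials of formal vector fields. -/

section FormalVectorFields

/-- `T` raises the order of vanishing at `0` by at least `m`. -/
def RaisesOrder (m : ℕ) (T : Module.End ℂ ℂ⟦X⟧) : Prop :=
  ∀ (n : ℕ) (p : ℂ⟦X⟧), X ^ n ∣ p → X ^ (n + m) ∣ T p

theorem RaisesOrder.pow {m : ℕ} {T : Module.End ℂ ℂ⟦X⟧} (hT : RaisesOrder m T) (k : ℕ) :
    RaisesOrder (m * k) (T ^ k) := by
  induction k with
  | zero => exact fun n p hp => by simpa using hp
  | succ k ih =>
    intro n p hp
    rw [pow_succ', Module.End.mul_apply, Nat.mul_succ, ← add_assoc]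
    exact hT _ _ (ih n p hp)

theorem RaisesOrder.coeff_pow_eq_zero {T : Module.End ℂ ℂ⟦X⟧} (hT : RaisesOrder 1 T) {k d : ℕ}
    (hd : d < k) (p : ℂ⟦X⟧) : coeff d ((T ^ k) p) = 0 := by
  have h := hT.pow k 0 p (by simp)
  exact X_pow_dvd_iff.mp h d (by omega)

/-- The exponential of an operator that raises orders of vanishing. -/
noncomputable def expSeries (T : Module.End ℂ ℂ⟦X⟧) (p : ℂ⟦X⟧) : ℂ⟦X⟧ :=
  PowerSeries.mk fun d => ∑ᶠ n : ℕ, ((n ! : ℂ)⁻¹) * coeff d ((T ^ n) p)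

theorem expDerivation_eq_expSeries (D : Derivation ℂ ℂ⟦X⟧ ℂ⟦X⟧) (p : ℂ⟦X⟧) :
    expDerivation D p = expSeries (D : ℂ⟦X⟧ →ₗ[ℂ] ℂ⟦X⟧) p := by
  simp only [expDerivation, expSeries, Module.End.pow_apply]
  rfl

theorem coeff_expSeries {T : Module.End ℂ ℂ⟦X⟧} (hT : RaisesOrder 1 T) {d K : ℕ} (hd : d < K)
    (p : ℂ⟦X⟧) : coeff d (expSeries T p) = coeff d (expTrunc K T p) := by
  rw [expSeries, coeff_mk, expTrunc_apply, map_sum,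
    finsum_eq_sum_of_support_subset (s := Finset.range K)]
  · simp
  · intro n hn
    by_contra h
    simp only [Finset.coe_range, Set.mem_Iio, not_lt] at h
    exact hn (by simp [hT.coeff_pow_eq_zero (lt_of_lt_of_le hd h)])

theorem X_pow_dvd_expSeries_sub {T : Module.End ℂ ℂ⟦X⟧} (hT : RaisesOrder 1 T) (K : ℕ)
    (p : ℂ⟦X⟧) : X ^ K ∣ expSeries T p - expTrunc K T p :=
  X_pow_dvd_iff.mpr fun d hd => by rw [map_sub, coeff_expSeries hT hd, sub_self]

theorem RaisesOrder.mono {m m' : ℕ} (h : m' ≤ m) {T : Module.End ℂ ℂ⟦X⟧} (hT : RaisesOrder m T) :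
    RaisesOrder m' T :=
  fun n p hp => (pow_dvd_pow X (by omega)).trans (hT n p hp)

/-- First-order approximation: the quadratic and later terms of the exponential each apply `T` at
least twice. -/
theorem X_pow_dvd_expSeries_sub_sub {m : ℕ} (hm : 1 ≤ m) {T : Module.End ℂ ℂ⟦X⟧}
    (hT : RaisesOrder m T) {n : ℕ} {p : ℂ⟦X⟧} (hp : X ^ n ∣ p) :
    X ^ (n + 2 * m) ∣ expSeries T p - p - T p := by
  have h1 := X_pow_dvd_expSeries_sub (hT.mono hm) (n + 2 * m) p
  obtain ⟨r, hr⟩ : ∃ r, n + 2 * m = 2 + r := ⟨n + 2 * m - 2, by omega⟩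
  have h2 : X ^ (n + 2 * m) ∣ expTrunc (n + 2 * m) T p - p - T p := by
    rw [expTrunc_apply, hr, Finset.sum_range_add, Finset.sum_range_succ, Finset.sum_range_one,
      ← hr]
    have : ∀ s : ℂ⟦X⟧, ((0 ! : ℂ)⁻¹) • (T ^ 0) p + ((1 ! : ℂ)⁻¹) • (T ^ 1) p + s - p - T p = s := by
      intro s
      simp only [Nat.factorial_zero, Nat.factorial_one, Nat.cast_one, inv_one, one_smul, pow_zero,
        pow_one, Module.End.one_apply]
      ring
    rw [this]
    refine Finset.dvd_sum fun k _ => ?_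
    rw [PowerSeries.smul_eq_C_mul]
    refine Dvd.dvd.mul_left ((pow_dvd_pow X ?_).trans (hT.pow (2 + k) n p hp)) _
    nlinarith
  have := dvd_add h1 h2
  convert this using 1
  ring

/-- The Euler derivation `x d/dx`. -/
noncomputable def eulerDerivation : Derivation ℂ ℂ⟦X⟧ ℂ⟦X⟧ :=
  (X : ℂ⟦X⟧) • PowerSeries.derivative ℂ

theorem coeff_eulerDerivation (n : ℕ) (p : ℂ⟦X⟧) :
    coeff n (eulerDerivation p) = n * coeff n p := by
  rw [eulerDerivation, Derivation.smul_apply, smul_eq_mul]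
  cases n with
  | zero => simp
  | succ n => rw [coeff_succ_X_mul, coeff_derivative]; push_cast; ring

theorem eulerDerivation_X : eulerDerivation X = X := by simp [eulerDerivation]

theorem X_pow_dvd_eulerDerivation {n : ℕ} {p : ℂ⟦X⟧} (hp : X ^ n ∣ p) :
    X ^ n ∣ eulerDerivation p :=
  X_pow_dvd_iff.mpr fun m hm => by
    rw [coeff_eulerDerivation, X_pow_dvd_iff.mp hp m hm, mul_zero]

/-- The operator `g(x) x d/dx`. -/
noncomputable def fieldOp (g : ℂ⟦X⟧) : Module.End ℂ ℂ⟦X⟧ :=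
  ((g • eulerDerivation : Derivation ℂ ℂ⟦X⟧ ℂ⟦X⟧) : ℂ⟦X⟧ →ₗ[ℂ] ℂ⟦X⟧)

@[simp] theorem fieldOp_apply (g p : ℂ⟦X⟧) : fieldOp g p = g * eulerDerivation p := rfl

/-- The operator `ad g` with `[g(x) x d/dx, h(x) x d/dx] = (ad g h)(x) x d/dx`. -/
noncomputable def adOp (g : ℂ⟦X⟧) : Module.End ℂ ℂ⟦X⟧ :=
  fieldOp g - LinearMap.mulRight ℂ (eulerDerivation g)

@[simp] theorem adOp_apply (g h : ℂ⟦X⟧) :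
    adOp g h = g * eulerDerivation h - h * eulerDerivation g := by
  simp [adOp]

theorem raisesOrder_fieldOp {m : ℕ} {g : ℂ⟦X⟧} (hg : X ^ m ∣ g) : RaisesOrder m (fieldOp g) := by
  intro n p hp
  rw [fieldOp_apply, add_comm, pow_add]
  exact mul_dvd_mul hg (X_pow_dvd_eulerDerivation hp)

theorem raisesOrder_adOp {m : ℕ} {g : ℂ⟦X⟧} (hg : X ^ m ∣ g) : RaisesOrder m (adOp g) := by
  intro n p hp
  rw [adOp_apply]
  refine dvd_sub ?_ ?_
  · rw [add_comm, pow_add]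
    exact mul_dvd_mul hg (X_pow_dvd_eulerDerivation hp)
  · rw [pow_add]
    exact mul_dvd_mul hp (X_pow_dvd_eulerDerivation hg)

/-- The bilinear map `(h, p) ↦ h(x) x p'(x)`. -/
noncomputable def fieldAction : ℂ⟦X⟧ →ₗ[ℂ] ℂ⟦X⟧ →ₗ[ℂ] ℂ⟦X⟧ :=
  (LinearMap.mul ℂ ℂ⟦X⟧).compl₂ (eulerDerivation : ℂ⟦X⟧ →ₗ[ℂ] ℂ⟦X⟧)

@[simp] theorem fieldAction_apply (h p : ℂ⟦X⟧) : fieldAction h p = h * eulerDerivation p := rfl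

/-- The bracket formula for `adOp` says that `fieldAction` obeys a Leibniz rule, so it intertwines
the exponentials. -/
theorem expSeries_mul_eulerDerivation {g : ℂ⟦X⟧} (hg : X ∣ g) (h p : ℂ⟦X⟧) :
    expSeries (fieldOp g) (h * eulerDerivation p) =
      expSeries (adOp g) h * eulerDerivation (expSeries (fieldOp g) p) := by
  have hg1 : (X : ℂ⟦X⟧) ^ 1 ∣ g := by simpa using hg
  have hD := raisesOrder_fieldOp hg1
  have ha := raisesOrder_adOp hg1
  ext d
  rw [coeff_expSeries hD (Nat.lt_succ_self d)]
  have h1 := expTrunc_bilinear fieldAction (D₁ := adOp g) (D₂ := fieldOp g) (D₃ := fieldOp g)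
    (fun x y => by simp; ring) (coeff d) (d + 1) h p (fun i j hij => by
      have h2 := mul_dvd_mul (ha.pow i 0 h (by simp))
        (X_pow_dvd_eulerDerivation (hD.pow j 0 p (by simp)))
      rw [← pow_add] at h2
      exact X_pow_dvd_iff.mp h2 d (by omega))
  rw [fieldAction_apply, fieldAction_apply] at h1
  rw [h1, eq_comm, ← sub_eq_zero, ← map_sub]
  refine X_pow_dvd_iff.mp ?_ d (Nat.lt_succ_self d)
  -- The two truncations are replaced one factor at a time.
  have h3 := (X_pow_dvd_expSeries_sub ha (d + 1) h).mul_right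
    (eulerDerivation (expSeries (fieldOp g) p))
  have h4 := (X_pow_dvd_eulerDerivation (X_pow_dvd_expSeries_sub hD (d + 1) p)).mul_left
    (expTrunc (d + 1) (adOp g) h)
  rw [map_sub] at h4
  convert dvd_add h3 h4 using 1
  ring

theorem vectorField_X_mul (g : ℂ⟦X⟧) : vectorField (X * g) = g • eulerDerivation := by
  ext p
  simp only [vectorField, eulerDerivation, Derivation.smul_apply, smul_eq_mul]
  congr 1
  ring

/-- The power series `∑ j ≥ 1, A j x^j`. -/
noncomputable def fieldSeries (A : ℕ+ → ℂ) : ℂ⟦X⟧ :=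
  PowerSeries.mk fun n => if h : 0 < n then A ⟨n, h⟩ else 0

theorem coeff_fieldSeries (A : ℕ+ → ℂ) (j : ℕ+) : coeff (j : ℕ) (fieldSeries A) = A j := by
  rw [fieldSeries, coeff_mk, dif_pos j.pos]
  rfl

theorem coeff_zero_fieldSeries (A : ℕ+ → ℂ) : coeff 0 (fieldSeries A) = 0 := by
  rw [fieldSeries, coeff_mk, dif_neg (lt_irrefl 0)]

theorem X_dvd_fieldSeries (A : ℕ+ → ℂ) : X ∣ fieldSeries A := by
  rw [X_dvd_iff, ← coeff_zero_eq_constantCoeff_apply, coeff_zero_fieldSeries]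

theorem coeffSeries_eq (A : ℕ+ → ℂ) : coeffSeries A = X * fieldSeries A := by
  ext n
  rcases n with _ | _ | n
  · simp [coeffSeries]
  · rw [coeff_succ_X_mul, coeff_zero_fieldSeries]
    simp [coeffSeries]
  · rw [coeff_succ_X_mul, coeffSeries, fieldSeries, coeff_mk, coeff_mk, dif_pos (by omega),
      dif_pos (by omega)]
    rfl

theorem expDerivation_vectorField_coeffSeries (A : ℕ+ → ℂ) (p : ℂ⟦X⟧) :
    expDerivation (vectorField (coeffSeries A)) p = expSeries (fieldOp (fieldSeries A)) p := by
  rw [coeffSeries_eq, vectorField_X_mul, expDerivation_eq_expSeries]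
  rfl

theorem expDerivation_smul_vectorField_X_pow (c : ℂ) (m : ℕ) (p : ℂ⟦X⟧) :
    expDerivation (c • vectorField (X ^ (m + 1))) p = expSeries (fieldOp (c • X ^ m)) p := by
  rw [pow_succ', vectorField_X_mul, expDerivation_eq_expSeries]
  congr 1
  ext1 q
  simp [fieldOp]

theorem X_pow_dvd_smul_X_pow (c : ℂ) (m : ℕ) : (X : ℂ⟦X⟧) ^ m ∣ c • X ^ m := by
  rw [PowerSeries.smul_eq_C_mul]
  exact dvd_mul_left _ _

theorem X_dvd_smul_X_pow (c : ℂ) (j : ℕ+) : (X : ℂ⟦X⟧) ∣ c • X ^ (j : ℕ) :=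
  (dvd_pow_self X j.ne_zero).trans (X_pow_dvd_smul_X_pow c j)

end FormalVectorFields

/-! ### Existence and uniqueness of the two decompositions. -/

section Decompositions

/-- The product of the first `N` factors of `⋯ exp(b 2 x^3 d/dx) exp(b 1 x^2 d/dx)` applied
to `x`. -/
noncomputable def prodSeries (b : ℕ+ → ℂ) (N : ℕ) : ℂ⟦X⟧ :=
  partialProduct (fun j : ℕ+ => expDerivation (b j • vectorField (X ^ ((j : ℕ) + 1)))) N X

theorem prodSeries_succ (b : ℕ+ → ℂ) (N : ℕ) :
    prodSeries b (N + 1) =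
      expSeries (fieldOp (b N.succPNat • X ^ (N + 1))) (prodSeries b N) := by
  rw [← expDerivation_smul_vectorField_X_pow]
  rfl

/-- Since p is x up to order 2, the linear term c x^m · x p' is c x^(m+1) up to order m + 2. The
higher terms have order at least 1 + 2m, which suffices because m ≥ 1. -/
theorem X_pow_dvd_expSeries_fieldOp_sub {m : ℕ} (hm : 1 ≤ m) (c : ℂ) {p : ℂ⟦X⟧}
    (hp : X ^ 2 ∣ p - X) :
    X ^ (m + 2) ∣ expSeries (fieldOp (c • X ^ m)) p - p - c • X ^ (m + 1) := by
  have hp1 : X ^ 1 ∣ p := by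
    have h := dvd_add ((pow_dvd_pow (X : ℂ⟦X⟧) (show 1 ≤ 2 by omega)).trans hp)
      (dvd_refl (X ^ 1))
    simpa using h
  have h1 := X_pow_dvd_expSeries_sub_sub hm
    (raisesOrder_fieldOp (X_pow_dvd_smul_X_pow c m)) hp1
  have h2 := mul_dvd_mul (X_pow_dvd_smul_X_pow c m) (X_pow_dvd_eulerDerivation hp)
  rw [← pow_add, map_sub, eulerDerivation_X] at h2
  convert dvd_add ((pow_dvd_pow X (show m + 2 ≤ 1 + 2 * m by omega)).trans h1) h2 using 1
  rw [fieldOp_apply]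
  simp only [PowerSeries.smul_eq_C_mul]
  ring

theorem X_sq_dvd_prodSeries_sub_X (b : ℕ+ → ℂ) (N : ℕ) : X ^ 2 ∣ prodSeries b N - X := by
  induction N with
  | zero => simp [prodSeries, partialProduct]
  | succ N ih =>
    rw [prodSeries_succ]
    have h1 := (pow_dvd_pow X (show 2 ≤ N + 1 + 2 by omega)).trans
      (X_pow_dvd_expSeries_fieldOp_sub (show 1 ≤ N + 1 by omega) (b N.succPNat) ih)
    have h2 := (pow_dvd_pow X (show 2 ≤ N + 1 + 1 by omega)).trans
      (X_pow_dvd_smul_X_pow (b N.succPNat) (N + 1 + 1))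
    convert dvd_add (dvd_add h1 h2) ih using 1
    ring

/-- This gives both the stabilization of coefficients and the triangularity of the system for b. -/
theorem coeff_prodSeries_succ (b : ℕ+ → ℂ) (N : ℕ) {d : ℕ} (hd : d ≤ N + 2) :
    coeff d (prodSeries b (N + 1)) =
      coeff d (prodSeries b N) + if d = N + 2 then b N.succPNat else 0 := by
  have h := X_pow_dvd_iff.mp (X_pow_dvd_expSeries_fieldOp_sub (show 1 ≤ N + 1 by omega)
    (b N.succPNat) (X_sq_dvd_prodSeries_sub_X b N)) d (by omega)
  rw [← prodSeries_succ, map_sub, map_sub, PowerSeries.coeff_smul, coeff_X_pow, smul_eq_mul,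
    mul_ite, mul_one, mul_zero] at h
  linear_combination h

theorem coeff_prodSeries_of_le (b : ℕ+ → ℂ) {d M N : ℕ} (hd : d ≤ M + 1) (hMN : M ≤ N) :
    coeff d (prodSeries b N) = coeff d (prodSeries b M) := by
  induction N, hMN using Nat.le_induction with
  | base => rfl
  | succ N hN ih => rw [coeff_prodSeries_succ b N (by omega), if_neg (by omega), add_zero, ih]

theorem prodSeries_congr {b b' : ℕ+ → ℂ} {N : ℕ} (h : ∀ j : ℕ+, (j : ℕ) ≤ N → b j = b' j) :
    prodSeries b N = prodSeries b' N := by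
  induction N with
  | zero => rfl
  | succ N ih =>
    rw [prodSeries_succ, prodSeries_succ, ih fun j hj => h j (by omega),
      h N.succPNat (by simp)]

/-- The coefficient of x^(n+1) is final after n factors, so the limit condition is one equation for
each n. -/
theorem isProductDecomposition_iff {f : ℂ⟦X⟧} (hf0 : coeff 0 f = 0) (hf1 : coeff 1 f = 1)
    (b : ℕ+ → ℂ) : IsProductDecomposition f b ↔
      (fun n : ℕ+ => coeff ((n : ℕ) + 1) (prodSeries b n)) = fun n : ℕ+ => coeff ((n : ℕ) + 1) f := by
  constructor
  · intro h
    funext n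
    obtain ⟨N, hN⟩ := ((h (n + 1)).and (eventually_ge_atTop (n : ℕ))).exists
    rw [← hN.1, ← coeff_prodSeries_of_le b le_rfl hN.2]
    rfl
  · intro h d
    have hX : ∀ N, ∀ d < 2, coeff d (prodSeries b N) = coeff d (X : ℂ⟦X⟧) := fun N d hd => by
      have := X_pow_dvd_iff.mp (X_sq_dvd_prodSeries_sub_X b N) d hd
      rwa [map_sub, sub_eq_zero] at this
    rcases d with _ | _ | d
    · refine Eventually.of_forall fun N => (hX N 0 (by omega)).trans ?_
      simp [hf0]
    · refine Eventually.of_forall fun N => (hX N 1 (by omega)).trans ?_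
      simp [hf1]
    · filter_upwards [eventually_ge_atTop (d + 1)] with N hN
      exact (coeff_prodSeries_of_le b le_rfl hN).trans (congrFun h d.succPNat)

theorem existsUnique_isProductDecomposition {f : ℂ⟦X⟧} (hf0 : coeff 0 f = 0)
    (hf1 : coeff 1 f = 1) : ∃! b : ℕ+ → ℂ, IsProductDecomposition f b := by
  simp only [isProductDecomposition_iff hf0 hf1]
  refine existsUnique_of_unitriangular
    (fun b n => coeff ((n : ℕ) + 1) (prodSeries b n)) (fun b b' n h => ?_) _
  obtain ⟨m, rfl⟩ : ∃ m : ℕ, n = m.succPNat := ⟨n.natPred, by simp⟩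
  have h1 : prodSeries b m = prodSeries b' m := prodSeries_congr fun j hj => h j (by
    rw [← PNat.coe_lt_coe, Nat.succPNat_coe]
    omega)
  simp only [Nat.succPNat_coe, Nat.succ_eq_add_one]
  rw [coeff_prodSeries_succ b m le_rfl, coeff_prodSeries_succ b' m le_rfl, h1, if_pos rfl,
    if_pos rfl]
  ring

/-- Telescoping: T^(k+2) - T'^(k+2) = T(T^(k+1) - T'^(k+1)) + (T - T')T'^(k+1). -/
theorem X_pow_dvd_pow_sub_pow {T T' : Module.End ℂ ℂ⟦X⟧} (hT : RaisesOrder 1 T)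
    (hT' : RaisesOrder 1 T') {n : ℕ} (h : RaisesOrder n (T - T')) {m : ℕ} {p : ℂ⟦X⟧}
    (hp : X ^ m ∣ p) (k : ℕ) : X ^ (m + n + k) ∣ (T ^ (k + 1)) p - (T' ^ (k + 1)) p := by
  induction k with
  | zero => simpa using h m p hp
  | succ k ih =>
    rw [pow_succ' T, pow_succ' T', Module.End.mul_apply, Module.End.mul_apply]
    have h1 := hT _ _ ih
    have h2 := h _ _ (hT'.pow (k + 1) m p hp)
    rw [map_sub] at h1
    rw [LinearMap.sub_apply, show m + 1 * (k + 1) + n = m + n + k + 1 by ring] at h2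
    have h3 := dvd_add h1 h2
    rwa [sub_add_sub_cancel] at h3

/-- Only the linear term of the exponential sees the n-th entry in degree n + 1; the quadratic and
later terms differ first in degree n + 2 or above. -/
theorem coeff_expSeries_fieldSeries_sub {A A' : ℕ+ → ℂ} {n : ℕ+} (h : ∀ j < n, A j = A' j) :
    coeff ((n : ℕ) + 1) (expSeries (fieldOp (fieldSeries A)) X) -
      coeff ((n : ℕ) + 1) (expSeries (fieldOp (fieldSeries A')) X) = A n - A' n := by
  have hR : ∀ A, RaisesOrder 1 (fieldOp (fieldSeries A)) := fun A =>
    raisesOrder_fieldOp (by simpa using X_dvd_fieldSeries A)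
  have hdvd : X ^ (n : ℕ) ∣ fieldSeries A - fieldSeries A' := X_pow_dvd_iff.mpr fun m hm => by
    rcases Nat.eq_zero_or_pos m with rfl | hpos
    · rw [map_sub, coeff_zero_fieldSeries, coeff_zero_fieldSeries, sub_zero]
    · lift m to ℕ+ using hpos
      rw [map_sub, coeff_fieldSeries, coeff_fieldSeries, h m hm, sub_self]
  have hsub : fieldOp (fieldSeries A) - fieldOp (fieldSeries A') =
      fieldOp (fieldSeries A - fieldSeries A') := by
    ext1 p
    simp [sub_mul]
  have hD := raisesOrder_fieldOp hdvd
  rw [← hsub] at hD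
  obtain ⟨r, hr⟩ : ∃ r, (n : ℕ) + 2 = 2 + r := ⟨n, by omega⟩
  rw [coeff_expSeries (hR A) (Nat.lt_succ_self _), coeff_expSeries (hR A') (Nat.lt_succ_self _),
    ← map_sub, expTrunc_apply, expTrunc_apply, ← Finset.sum_sub_distrib, map_sum,
    Finset.sum_eq_single 1]
  · rw [Nat.factorial_one, Nat.cast_one, inv_one, one_smul, one_smul, pow_one, pow_one,
      fieldOp_apply, fieldOp_apply, eulerDerivation_X, map_sub, coeff_succ_mul_X,
      coeff_succ_mul_X, coeff_fieldSeries, coeff_fieldSeries]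
  · intro k _ hk
    rcases k with _ | _ | k
    · simp
    · exact absurd rfl hk
    · rw [← smul_sub, PowerSeries.coeff_smul]
      have := X_pow_dvd_pow_sub_pow (hR A) (hR A') hD (show X ^ 1 ∣ (X : ℂ⟦X⟧) by simp) (k + 1)
      rw [X_pow_dvd_iff.mp this _ (by omega), smul_zero]
  · intro hn
    have := n.pos
    simp at hn

theorem X_sq_dvd_expSeries_fieldSeries_sub_X (A : ℕ+ → ℂ) :
    X ^ 2 ∣ expSeries (fieldOp (fieldSeries A)) X - X := by
  have hR : RaisesOrder 1 (fieldOp (fieldSeries A)) :=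
    raisesOrder_fieldOp (by simpa using X_dvd_fieldSeries A)
  have h1 := X_pow_dvd_expSeries_sub_sub le_rfl hR (show X ^ 1 ∣ (X : ℂ⟦X⟧) by simp)
  have h2 := hR 1 X (by simp)
  convert dvd_add ((pow_dvd_pow X (show 2 ≤ 1 + 2 * 1 by omega)).trans h1) h2 using 1
  ring

theorem isExponentialForm_iff {f : ℂ⟦X⟧} (hf0 : coeff 0 f = 0) (hf1 : coeff 1 f = 1)
    (A : ℕ+ → ℂ) : IsExponentialForm f A ↔
      (fun n : ℕ+ => coeff ((n : ℕ) + 1) (expSeries (fieldOp (fieldSeries A)) X)) =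
        fun n : ℕ+ => coeff ((n : ℕ) + 1) f := by
  rw [IsExponentialForm, expDerivation_vectorField_coeffSeries]
  constructor
  · rintro rfl
    rfl
  · intro h
    ext d
    have hX : ∀ d < 2, coeff d (expSeries (fieldOp (fieldSeries A)) X) = coeff d (X : ℂ⟦X⟧) :=
      fun d hd => by
        have := X_pow_dvd_iff.mp (X_sq_dvd_expSeries_fieldSeries_sub_X A) d hd
        rwa [map_sub, sub_eq_zero] at this
    rcases d with _ | _ | d
    · rw [hX 0 (by omega), hf0, coeff_zero_X]
    · rw [hX 1 (by omega), hf1, coeff_one_X]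
    · exact congrFun h d.succPNat

theorem existsUnique_isExponentialForm {f : ℂ⟦X⟧} (hf0 : coeff 0 f = 0) (hf1 : coeff 1 f = 1) :
    ∃! A : ℕ+ → ℂ, IsExponentialForm f A := by
  simp only [isExponentialForm_iff hf0 hf1]
  exact existsUnique_of_unitriangular
    (fun A n => coeff ((n : ℕ) + 1) (expSeries (fieldOp (fieldSeries A)) X))
    (fun A A' n h => coeff_expSeries_fieldSeries_sub h) _

/-! ### The transform of the Euler field. -/

/-- The series `h` with `h(x) x d/dx` the transform of `x d/dx` under the product of the first `N`
factors of `⋯ exp(b 2 x^3 d/dx) exp(b 1 x^2 d/dx)`. -/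
noncomputable def prodAd (b : ℕ+ → ℂ) (N : ℕ) : ℂ⟦X⟧ :=
  partialProduct (fun j : ℕ+ => expSeries (adOp (b j • X ^ (j : ℕ)))) N 1

theorem prodAd_succ (b : ℕ+ → ℂ) (N : ℕ) :
    prodAd b (N + 1) = expSeries (adOp (b N.succPNat • X ^ (N + 1))) (prodAd b N) := rfl

/-- Each factor is applied to both sides of the identity, starting from x = 1·x·(dx/dx). -/
theorem prodSeries_eq_prodAd_mul (b : ℕ+ → ℂ) (N : ℕ) :
    prodSeries b N = prodAd b N * eulerDerivation (prodSeries b N) := by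
  induction N with
  | zero => simp [prodSeries, prodAd, partialProduct, eulerDerivation_X]
  | succ N ih =>
    rw [prodSeries_succ, prodAd_succ]
    conv_lhs => rw [ih]
    exact expSeries_mul_eulerDerivation (X_dvd_smul_X_pow (b N.succPNat) N.succPNat) _ _

/-- Both series approximate or equal f/(x f'). As x f' is x times a unit, dividing by it costs one
power of x, hence m + 1 in the proof. -/
theorem eventually_X_pow_dvd_prodAd_sub {f : ℂ⟦X⟧} (hf0 : coeff 0 f = 0) (hf1 : coeff 1 f = 1)
    {b A : ℕ+ → ℂ} (hb : IsProductDecomposition f b) (hA : IsExponentialForm f A) (m : ℕ) :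
    ∀ᶠ N : ℕ in atTop, X ^ m ∣ prodAd b N - expSeries (adOp (fieldSeries A)) 1 := by
  set h := expSeries (adOp (fieldSeries A)) 1 with hh
  have hf : f = h * eulerDerivation f := by
    have h1 := expSeries_mul_eulerDerivation (X_dvd_fieldSeries A) 1 X
    rw [one_mul, eulerDerivation_X, ← expDerivation_vectorField_coeffSeries] at h1
    rwa [IsExponentialForm.eq_1 f A |>.mp hA] at h1
  obtain ⟨u, hu⟩ : X ∣ eulerDerivation f := by
    rw [X_dvd_iff, ← coeff_zero_eq_constantCoeff_apply, coeff_eulerDerivation, hf0, mul_zero]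
  have hu1 : IsUnit u := by
    rw [PowerSeries.isUnit_iff_constantCoeff, ← coeff_zero_eq_constantCoeff_apply,
      ← coeff_succ_X_mul, ← hu, coeff_eulerDerivation, zero_add, hf1]
    simp
  have hev : ∀ᶠ N : ℕ in atTop, ∀ d ∈ Finset.range (m + 1),
      coeff d (prodSeries b N) = coeff d f := by
    rw [Finset.eventually_all]
    exact fun d _ => hb d
  filter_upwards [hev] with N hN
  have h1 : X ^ (m + 1) ∣ prodSeries b N - f := X_pow_dvd_iff.mpr fun d hd => by
    rw [map_sub, hN d (Finset.mem_range.mpr hd), sub_self]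
  have h2 : X ^ (m + 1) ∣ (prodAd b N - h) * eulerDerivation f := by
    have h3 := dvd_sub h1 ((X_pow_dvd_eulerDerivation h1).mul_left (prodAd b N))
    rw [map_sub] at h3
    convert h3 using 1
    linear_combination (-1 : ℂ⟦X⟧) * prodSeries_eq_prodAd_mul b N + hf
  rw [hu, pow_succ, mul_comm X u, ← mul_assoc] at h2
  exact (IsUnit.dvd_mul_right hu1).mp ((mul_dvd_mul_iff_right X_ne_zero).mp h2)

theorem coeff_zero_expSeries_adOp {g : ℂ⟦X⟧} (hg : X ∣ g) (h : ℂ⟦X⟧) :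
    coeff 0 (expSeries (adOp g) h) = coeff 0 h := by
  rw [coeff_expSeries (raisesOrder_adOp (by simpa using hg)) Nat.zero_lt_one]
  simp [expTrunc]

end Decompositions

/-! ### The filtration of V by conformal weight. -/

namespace VertexOperatorAlgebra

variable {V : Type*} [AddCommGroup V] [Module ℂ V] (𝒱 : VertexOperatorAlgebra V)

/-- For nonnegative indices the central term could occur only at i = j = 0, where m³ - m vanishes.
-/
theorem L_L_apply_sub (i j : ℕ) (v : V) :
    𝒱.L i (𝒱.L j v) - 𝒱.L j (𝒱.L i v) = ((i : ℂ) - j) • 𝒱.L (i + j : ℕ) v := by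
  have h := LinearMap.congr_fun (𝒱.virasoro i j) v
  have h0 : (if (i : ℤ) + j = 0 then (((i : ℤ) : ℂ) ^ 3 - (i : ℤ)) / 12 * 𝒱.centralCharge
      else 0) = 0 := by
    split_ifs with hij
    · obtain rfl : i = 0 := by omega
      simp
    · rfl
  rw [h0, zero_smul, add_zero, Ring.lie_def] at h
  simpa [L] using h

/-- The `n`-eigenspace of `L(0)`. -/
noncomputable def eigen (n : ℤ) : Submodule ℂ V := Module.End.eigenspace (𝒱.L 0) (n : ℂ)

theorem mem_eigen {n : ℤ} {v : V} : v ∈ 𝒱.eigen n ↔ 𝒱.L 0 v = (n : ℂ) • v :=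
  Module.End.mem_eigenspace_iff

theorem weightSpace_le_eigen (n : ℤ) : 𝒱.weightSpace n ≤ 𝒱.eigen n := fun v hv =>
  𝒱.mem_eigen.mpr (𝒱.weight_apply n v hv)

theorem iSup_eigen : ⨆ n, 𝒱.eigen n = ⊤ :=
  top_le_iff.mp (𝒱.isInternal.submodule_iSup_eq_top.symm.le.trans
    (iSup_mono 𝒱.weightSpace_le_eigen))

/-- If the weight space is zero, the other eigenspaces already span V, and eigenspaces are
independent. Eigenspaces are used because the Virasoro relations speak of eigenvalues directly. -/
theorem eigen_eq_bot {n : ℤ} (hn : 𝒱.weightSpace n = ⊥) : 𝒱.eigen n = ⊥ := by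
  have hind := (Module.End.eigenspaces_iSupIndep (𝒱.L 0)).comp
    (f := fun m : ℤ => (m : ℂ)) Int.cast_injective
  have hle : (⊤ : Submodule ℂ V) ≤ ⨆ (m) (_ : m ≠ n), 𝒱.eigen m := by
    rw [← 𝒱.isInternal.submodule_iSup_eq_top]
    refine iSup_le fun m => ?_
    rcases eq_or_ne m n with rfl | hmn
    · rw [hn]
      exact bot_le
    · exact (𝒱.weightSpace_le_eigen m).trans (le_iSup₂_of_le m hmn le_rfl)
  have h := hind n
  exact disjoint_self.mp (h.mono_right (le_top.trans hle))

theorem L_mem_eigen {n : ℤ} {v : V} (hv : v ∈ 𝒱.eigen n) (j : ℕ) :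
    𝒱.L j v ∈ 𝒱.eigen (n - j) := by
  rw [mem_eigen] at hv ⊢
  have h := 𝒱.L_L_apply_sub 0 j v
  rw [Nat.cast_zero, hv, map_smul, zero_add, sub_eq_iff_eq_add] at h
  rw [h, ← add_smul]
  congr 1
  push_cast
  ring

/-- A lower bound for the conformal weights. -/
noncomputable def minWeight : ℤ := 𝒱.bounded_below.choose

theorem eigen_eq_bot_of_lt {n : ℤ} (hn : n < 𝒱.minWeight) : 𝒱.eigen n = ⊥ :=
  𝒱.eigen_eq_bot (𝒱.bounded_below.choose_spec n hn)

/-- The sum of the spaces of conformal weight less than `minWeight + k`. -/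
noncomputable def filtration (k : ℕ) : Submodule ℂ V :=
  ⨆ (n : ℤ) (_ : n < 𝒱.minWeight + k), 𝒱.eigen n

theorem eigen_le_filtration {n : ℤ} {k : ℕ} (h : n < 𝒱.minWeight + k) :
    𝒱.eigen n ≤ 𝒱.filtration k :=
  le_iSup₂_of_le n h le_rfl

theorem filtration_zero : 𝒱.filtration 0 = ⊥ := by
  refine eq_bot_iff.mpr (iSup₂_le fun n hn => ?_)
  rw [𝒱.eigen_eq_bot_of_lt (by simpa using hn)]

theorem eq_zero_of_mem_filtration {k : ℕ} (hk : k = 0) {v : V} (hv : v ∈ 𝒱.filtration k) :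
    v = 0 := by
  subst hk
  rwa [filtration_zero, Submodule.mem_bot] at hv

theorem filtration_mono : Monotone 𝒱.filtration := fun _ _ hkl =>
  iSup₂_le fun _ hn => 𝒱.eigen_le_filtration (by omega)

theorem exists_mem_filtration (v : V) : ∃ k, v ∈ 𝒱.filtration k := by
  rw [← Submodule.mem_iSup_of_directed _ 𝒱.filtration_mono.directed_le]
  suffices h : ⨆ n, 𝒱.eigen n ≤ ⨆ k, 𝒱.filtration k by
    rw [iSup_eigen] at h
    exact h trivial
  refine iSup_le fun n => le_iSup_of_le (n - 𝒱.minWeight + 1).toNat ?_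
  exact 𝒱.eigen_le_filtration (by omega)

theorem mem_filtration_of_forall_eigen {T : Module.End ℂ V} {k l : ℕ}
    (h : ∀ n < 𝒱.minWeight + k, ∀ v ∈ 𝒱.eigen n, T v ∈ 𝒱.filtration l) {v : V}
    (hv : v ∈ 𝒱.filtration k) : T v ∈ 𝒱.filtration l := by
  have : 𝒱.filtration k ≤ (𝒱.filtration l).comap T := iSup₂_le fun n hn v hv => h n hn v hv
  exact this hv

/-- `T` lowers the filtration by conformal weight by at least `m`. -/
def Lowers (m : ℕ) (T : Module.End ℂ V) : Prop :=
  ∀ (k : ℕ) (v : V), v ∈ 𝒱.filtration k → T v ∈ 𝒱.filtration (k - m)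

/-- The truncated subtraction in `Lowers` is harmless: there is nothing below the minimal weight, so
level 0 of the filtration is zero. -/
theorem lowers_L (j : ℕ) : 𝒱.Lowers j (𝒱.L j) := fun k v hv =>
  𝒱.mem_filtration_of_forall_eigen (fun n hn w hw => by
    have h := 𝒱.L_mem_eigen hw j
    by_cases hkj : j ≤ k
    · exact 𝒱.eigen_le_filtration (by omega) h
    · rw [𝒱.eigen_eq_bot_of_lt (by omega), Submodule.mem_bot] at h
      rw [h]
      exact zero_mem _) hv

variable {𝒱}

theorem Lowers.mono {m m' : ℕ} (h : m' ≤ m) {T : Module.End ℂ V} (hT : 𝒱.Lowers m T) :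
    𝒱.Lowers m' T :=
  fun k v hv => 𝒱.filtration_mono (by omega) (hT k v hv)

theorem Lowers.neg {m : ℕ} {T : Module.End ℂ V} (hT : 𝒱.Lowers m T) : 𝒱.Lowers m (-T) :=
  fun k v hv => Submodule.neg_mem _ (hT k v hv)

theorem Lowers.pow {T : Module.End ℂ V} (hT : 𝒱.Lowers 1 T) (n : ℕ) : 𝒱.Lowers n (T ^ n) := by
  induction n with
  | zero => exact fun k v hv => by simpa using hv
  | succ n ih =>
    intro k v hv
    rw [pow_succ', Module.End.mul_apply, ← Nat.sub_sub]
    exact hT _ _ (ih k v hv)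

theorem Lowers.pow_eq_zero {T : Module.End ℂ V} (hT : 𝒱.Lowers 1 T) {n k : ℕ} (hkn : k ≤ n)
    {v : V} (hv : v ∈ 𝒱.filtration k) : (T ^ n) v = 0 :=
  𝒱.eq_zero_of_mem_filtration (Nat.sub_eq_zero_of_le hkn) (hT.pow n k v hv)

theorem Lowers.isLocallyNilpotent {T : Module.End ℂ V} (hT : 𝒱.Lowers 1 T) :
    IsLocallyNilpotent T := fun v => by
  obtain ⟨k, hk⟩ := 𝒱.exists_mem_filtration v
  exact ⟨k, hT.pow_eq_zero le_rfl hk⟩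

theorem Lowers.expEnd_eq {T : Module.End ℂ V} (hT : 𝒱.Lowers 1 T) {k K : ℕ} (hkK : k ≤ K)
    {v : V} (hv : v ∈ 𝒱.filtration k) : expEnd T v = expTrunc K T v := by
  rw [expEnd, expTrunc_apply, finsum_eq_sum_of_support_subset]
  intro n hn
  by_contra h
  simp only [Finset.coe_range, Set.mem_Iio, not_lt] at h
  exact hn (by simp only [hT.pow_eq_zero (hkK.trans h) hv, smul_zero])

/-- The exponential of an operator that lowers the filtration, as a linear map. -/
noncomputable def Lowers.exp {T : Module.End ℂ V} (hT : 𝒱.Lowers 1 T) : Module.End ℂ V where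
  toFun := expEnd T
  map_add' v w := by
    obtain ⟨k, hk⟩ := 𝒱.exists_mem_filtration v
    obtain ⟨l, hl⟩ := 𝒱.exists_mem_filtration w
    have hk' := 𝒱.filtration_mono (le_max_left k l) hk
    have hl' := 𝒱.filtration_mono (le_max_right k l) hl
    rw [hT.expEnd_eq le_rfl hk', hT.expEnd_eq le_rfl hl', hT.expEnd_eq le_rfl (add_mem hk' hl'),
      map_add]
  map_smul' c v := by
    obtain ⟨k, hk⟩ := 𝒱.exists_mem_filtration v
    rw [hT.expEnd_eq le_rfl hk, hT.expEnd_eq le_rfl (Submodule.smul_mem _ c hk), map_smul,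
      RingHom.id_apply]

theorem Lowers.exp_apply {T : Module.End ℂ V} (hT : 𝒱.Lowers 1 T) (v : V) :
    hT.exp v = expEnd T v := rfl

theorem Lowers.exp_sub_one {T : Module.End ℂ V} (hT : 𝒱.Lowers 1 T) :
    𝒱.Lowers 1 (hT.exp - 1) := by
  intro k v hv
  rw [LinearMap.sub_apply, hT.exp_apply, hT.expEnd_eq (Nat.le_succ k) hv, expTrunc_apply,
    Finset.sum_range_succ']
  simp only [Nat.factorial_zero, Nat.cast_one, inv_one, pow_zero, one_smul, add_sub_cancel_right]
  exact Submodule.sum_mem _ fun n _ => Submodule.smul_mem _ _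
    (𝒱.filtration_mono (by omega) (hT.pow (n + 1) k v hv))

theorem mem_filtration_of_lowers_sub_one {S : Module.End ℂ V} (hS : 𝒱.Lowers 1 (S - 1)) {k : ℕ}
    {v : V} (hv : v ∈ 𝒱.filtration k) : S v ∈ 𝒱.filtration k := by
  have h := add_mem (𝒱.filtration_mono (Nat.sub_le k 1) (hS k v hv)) hv
  simpa using h

/-- Induction along the filtration: v = S v - (S - 1)v, and the last term is one level lower. -/
theorem bijective_of_lowers_sub_one {S : Module.End ℂ V} (hS : 𝒱.Lowers 1 (S - 1)) :
    Function.Bijective S := by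
  constructor
  · rw [injective_iff_map_eq_zero]
    intro v hv
    obtain ⟨k, hk⟩ := 𝒱.exists_mem_filtration v
    induction k with
    | zero => exact 𝒱.eq_zero_of_mem_filtration rfl hk
    | succ k ih =>
      have h := hS _ v hk
      rw [LinearMap.sub_apply, hv, zero_sub, Module.End.one_apply] at h
      exact ih (by simpa using h)
  · have h : ∀ k, 𝒱.filtration k ≤ LinearMap.range S := by
      intro k
      induction k with
      | zero => exact 𝒱.filtration_zero.trans_le bot_le
      | succ k ih =>
        intro v hv
        have h0 : (S - 1) v ∈ 𝒱.filtration k := hS (k + 1) v hv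
        have h1 := sub_mem (LinearMap.mem_range_self S v) (ih h0)
        rwa [LinearMap.sub_apply, Module.End.one_apply, sub_sub_cancel] at h1
    intro v
    obtain ⟨k, hk⟩ := 𝒱.exists_mem_filtration v
    exact h k hk

/-! ### The action of formal vector fields on V. -/

variable (𝒱)

theorem finsum_coeff_smul_L_eq {k : ℕ} {v : V} (hv : v ∈ 𝒱.filtration k) (h : ℂ⟦X⟧) :
    ∑ᶠ j : ℕ, coeff j h • 𝒱.L j v = ∑ j ∈ Finset.range k, coeff j h • 𝒱.L j v := by
  rw [finsum_eq_sum_of_support_subset]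
  intro j hj
  by_contra hjk
  simp only [Finset.coe_range, Set.mem_Iio, not_lt] at hjk
  exact hj (by
    simp only [𝒱.eq_zero_of_mem_filtration (Nat.sub_eq_zero_of_le hjk) (𝒱.lowers_L j k v hv),
      smul_zero])

/-- The action `h ↦ ∑ j ≥ 0, h_j L(j)` of the formal vector field `-h(x) x d/dx` on a vertex
operator algebra. -/
noncomputable def fieldRep : ℂ⟦X⟧ →ₗ[ℂ] Module.End ℂ V :=
  LinearMap.mk₂ ℂ (fun h v => ∑ᶠ j : ℕ, coeff j h • 𝒱.L j v)
    (fun h h' v => by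
      obtain ⟨k, hk⟩ := 𝒱.exists_mem_filtration v
      rw [𝒱.finsum_coeff_smul_L_eq hk, 𝒱.finsum_coeff_smul_L_eq hk, 𝒱.finsum_coeff_smul_L_eq hk,
        ← Finset.sum_add_distrib]
      simp only [map_add, add_smul])
    (fun c h v => by
      obtain ⟨k, hk⟩ := 𝒱.exists_mem_filtration v
      rw [𝒱.finsum_coeff_smul_L_eq hk, 𝒱.finsum_coeff_smul_L_eq hk, Finset.smul_sum]
      simp only [map_smul, smul_assoc])
    (fun h v w => by
      obtain ⟨k, hk⟩ := 𝒱.exists_mem_filtration v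
      obtain ⟨l, hl⟩ := 𝒱.exists_mem_filtration w
      have hk' := 𝒱.filtration_mono (le_max_left k l) hk
      have hl' := 𝒱.filtration_mono (le_max_right k l) hl
      rw [𝒱.finsum_coeff_smul_L_eq hk', 𝒱.finsum_coeff_smul_L_eq hl',
        𝒱.finsum_coeff_smul_L_eq (add_mem hk' hl'), ← Finset.sum_add_distrib]
      simp only [map_add, smul_add])
    (fun c h v => by
      obtain ⟨k, hk⟩ := 𝒱.exists_mem_filtration v
      rw [𝒱.finsum_coeff_smul_L_eq hk, 𝒱.finsum_coeff_smul_L_eq (Submodule.smul_mem _ c hk),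
        Finset.smul_sum]
      simp only [map_smul, smul_comm c])

theorem fieldRep_apply (h : ℂ⟦X⟧) (v : V) :
    𝒱.fieldRep h v = ∑ᶠ j : ℕ, coeff j h • 𝒱.L j v := rfl

theorem fieldRep_X_pow (j : ℕ) : 𝒱.fieldRep (X ^ j) = 𝒱.L j := by
  ext v
  rw [fieldRep_apply, finsum_eq_single _ j fun i hi => by rw [coeff_X_pow, if_neg hi, zero_smul],
    coeff_X_pow_self, one_smul]

theorem fieldRep_one : 𝒱.fieldRep 1 = 𝒱.L 0 := 𝒱.fieldRep_X_pow 0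

theorem sumL_eq_fieldRep (A : ℕ+ → ℂ) : 𝒱.sumL A = 𝒱.fieldRep (fieldSeries A) := by
  ext v
  rw [fieldRep_apply]
  change ∑ᶠ j : ℕ+, A j • 𝒱.L j v = _
  simp only [← coeff_fieldSeries A]
  rw [← finsum_mem_range (f := fun j : ℕ => coeff j (fieldSeries A) • 𝒱.L j v)
    PNat.coe_injective]
  refine finsum_congr fun j => ?_
  rcases Nat.eq_zero_or_pos j with rfl | hj
  · rw [coeff_zero_fieldSeries, zero_smul, finsum_zero]
  · have hmem : j ∈ Set.range ((↑) : ℕ+ → ℕ) := ⟨⟨j, hj⟩, rfl⟩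
    simp only [hmem, finsum_true]

/-- Order of vanishing in x becomes lowering of weight, so congruences of series modulo x^k suffice
on level k of the filtration. -/
theorem lowers_fieldRep {m : ℕ} {h : ℂ⟦X⟧} (hh : X ^ m ∣ h) : 𝒱.Lowers m (𝒱.fieldRep h) := by
  intro k v hv
  rw [fieldRep_apply, 𝒱.finsum_coeff_smul_L_eq hv]
  refine Submodule.sum_mem _ fun j _ => ?_
  by_cases hj : j < m
  · rw [X_pow_dvd_iff.mp hh j hj, zero_smul]
    exact zero_mem _
  · exact Submodule.smul_mem _ _ (𝒱.filtration_mono (by omega) (𝒱.lowers_L j k v hv))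

theorem fieldRep_eq_of_X_pow_dvd_sub {k : ℕ} {h h' : ℂ⟦X⟧} (hh : X ^ k ∣ h - h') {v : V}
    (hv : v ∈ 𝒱.filtration k) : 𝒱.fieldRep h v = 𝒱.fieldRep h' v := by
  rw [← sub_eq_zero, ← LinearMap.sub_apply, ← map_sub]
  exact 𝒱.eq_zero_of_mem_filtration (Nat.sub_self k) (𝒱.lowers_fieldRep hh k v hv)

end VertexOperatorAlgebra

/-- A series is a polynomial plus a multiple of x^k, so linear identities continuous in this sense
can be checked on monomials. -/
theorem PowerSeries.linearMap_eq_zero {N : Type*} [AddCommGroup N] [Module ℂ N]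
    (P : ℂ⟦X⟧ →ₗ[ℂ] N) (hX : ∀ j : ℕ, P (X ^ j) = 0) (k : ℕ) (hk : ∀ r, X ^ k ∣ r → P r = 0)
    (h : ℂ⟦X⟧) : P h = 0 := by
  have h1 : X ^ k ∣ h - ∑ j ∈ Finset.range k, coeff j h • (X : ℂ⟦X⟧) ^ j :=
    X_pow_dvd_iff.mpr fun m hm => by
      rw [map_sub, map_sum]
      simp [coeff_X_pow, hm]
  have h2 := hk _ h1
  rw [map_sub, map_sum, sub_eq_zero] at h2
  rw [h2]
  exact Finset.sum_eq_zero fun j _ => by rw [map_smul, hX, smul_zero]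

namespace VertexOperatorAlgebra

variable {V : Type*} [AddCommGroup V] [Module ℂ V] (𝒱 : VertexOperatorAlgebra V)

theorem adOp_X_pow (i j : ℕ) : adOp (X ^ i) (X ^ j) = ((j : ℂ) - i) • X ^ (i + j) := by
  have h : ∀ n : ℕ, eulerDerivation (X ^ n) = (n : ℂ) • X ^ n := fun n => by
    ext m
    rw [coeff_eulerDerivation, PowerSeries.coeff_smul, coeff_X_pow, smul_eq_mul]
    split_ifs with hmn
    · rw [hmn]
    · simp
  rw [adOp_apply, h, h, mul_smul_comm, mul_smul_comm, ← pow_add, ← pow_add, add_comm j i,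
    sub_smul]

theorem adOp_swap (g h : ℂ⟦X⟧) : adOp g h = -adOp h g := by
  rw [adOp_apply, adOp_apply]
  ring

/-- On monomials this is the Virasoro relation; the reduction to monomials is made in h, then in g.
The bracket comes out reversed because L(j) corresponds to minus the field, which is why exp(-ρ(g))
appears below. -/
theorem fieldRep_adOp (g h : ℂ⟦X⟧) (v : V) :
    𝒱.fieldRep (adOp g h) v = 𝒱.fieldRep h (𝒱.fieldRep g v) - 𝒱.fieldRep g (𝒱.fieldRep h v) := by
  obtain ⟨k, hk⟩ := 𝒱.exists_mem_filtration v
  have hpres : ∀ g, 𝒱.fieldRep g v ∈ 𝒱.filtration k := fun g =>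
    𝒱.lowers_fieldRep (m := 0) (by simp) k v hk
  have hzero : ∀ r, X ^ k ∣ r → ∀ w ∈ 𝒱.filtration k, 𝒱.fieldRep r w = 0 := fun r hr w hw => by
    rw [𝒱.fieldRep_eq_of_X_pow_dvd_sub (h' := 0) (by simpa using hr) hw, map_zero,
      LinearMap.zero_apply]
  have had : ∀ g r : ℂ⟦X⟧, X ^ k ∣ r → X ^ k ∣ adOp g r := fun g r hr =>
    raisesOrder_adOp (m := 0) (by simp) k r hr
  have key : ∀ (i : ℕ) (h : ℂ⟦X⟧), 𝒱.fieldRep (adOp (X ^ i) h) v -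
      (𝒱.fieldRep h (𝒱.fieldRep (X ^ i) v) - 𝒱.fieldRep (X ^ i) (𝒱.fieldRep h v)) = 0 := by
    intro i
    refine PowerSeries.linearMap_eq_zero
      (𝒱.fieldRep.flip v ∘ₗ adOp (X ^ i) - (𝒱.fieldRep.flip (𝒱.fieldRep (X ^ i) v) -
        𝒱.fieldRep (X ^ i) ∘ₗ 𝒱.fieldRep.flip v)) (fun j => ?_) k (fun r hr => ?_)
    · simp only [LinearMap.sub_apply, LinearMap.comp_apply, LinearMap.flip_apply, adOp_X_pow,
        map_smul, fieldRep_X_pow]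
      rw [L_L_apply_sub, add_comm j i, sub_self]
    · simp only [LinearMap.sub_apply, LinearMap.comp_apply, LinearMap.flip_apply]
      rw [hzero _ (had _ r hr) v hk, hzero r hr _ (hpres _), hzero r hr v hk, map_zero]
      simp
  rw [← sub_eq_zero]
  have := PowerSeries.linearMap_eq_zero
    (-(𝒱.fieldRep.flip v ∘ₗ adOp h) - (𝒱.fieldRep h ∘ₗ 𝒱.fieldRep.flip v -
        𝒱.fieldRep.flip (𝒱.fieldRep h v))) (fun i => ?_) k (fun r hr => ?_) g
  · simp only [LinearMap.sub_apply, LinearMap.comp_apply, LinearMap.flip_apply,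
      LinearMap.neg_apply] at this
    rwa [adOp_swap, map_neg, LinearMap.neg_apply]
  · simp only [LinearMap.sub_apply, LinearMap.comp_apply, LinearMap.flip_apply,
      LinearMap.neg_apply]
    rw [← key i h, adOp_swap (X ^ i) h, map_neg, LinearMap.neg_apply]
  · simp only [LinearMap.sub_apply, LinearMap.comp_apply, LinearMap.flip_apply,
      LinearMap.neg_apply]
    rw [hzero _ (had _ r hr) v hk, hzero r hr _ (hpres _), hzero r hr v hk, map_zero]
    simp

variable {g : ℂ⟦X⟧}

theorem lowers_neg_fieldRep (hg : X ∣ g) : 𝒱.Lowers 1 (-𝒱.fieldRep g) :=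
  (𝒱.lowers_fieldRep (m := 1) (by simpa using hg)).neg

/-- Conjugation by `exp(-g)` acts on vector fields by `exp(ad g)`. -/
theorem expEnd_fieldRep (hg : X ∣ g) (h : ℂ⟦X⟧) (v : V) :
    expEnd (-𝒱.fieldRep g) (𝒱.fieldRep h v) =
      𝒱.fieldRep (expSeries (adOp g) h) (expEnd (-𝒱.fieldRep g) v) := by
  obtain ⟨k, hk⟩ := 𝒱.exists_mem_filtration v
  have hT := 𝒱.lowers_neg_fieldRep hg
  have ha : RaisesOrder 1 (adOp g) := raisesOrder_adOp (by simpa using hg)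
  have h1 := expTrunc_bilinear 𝒱.fieldRep (D₁ := adOp g) (D₂ := -𝒱.fieldRep g)
    (D₃ := -𝒱.fieldRep g) (fun x y => by
      simp only [fieldRep_adOp, LinearMap.neg_apply, map_neg]
      abel) LinearMap.id k h v (fun i j hij => by
      refine 𝒱.eq_zero_of_mem_filtration ?_ (𝒱.lowers_fieldRep (ha.pow i 0 h (by simp)) _ _
        (hT.pow j k v hk))
      omega)
  rw [LinearMap.id_apply, LinearMap.id_apply] at h1
  rw [hT.expEnd_eq (Nat.sub_le k 0) (𝒱.lowers_fieldRep (m := 0) (by simp) k v hk), h1]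
  have hmem := mem_filtration_of_lowers_sub_one hT.exp_sub_one hk
  rw [hT.exp_apply] at hmem
  rw [𝒱.fieldRep_eq_of_X_pow_dvd_sub (X_pow_dvd_expSeries_sub ha k h) hmem,
    hT.expEnd_eq le_rfl hk]

/-! ### Comparison of the two automorphisms. -/

/-- As h has constant term 1, its action is L(0) plus lowering terms; on the graded pieces of level
k its eigenvalues are weights below `minWeight` + k, hence never n. -/
theorem eq_zero_of_fieldRep_eq_smul {h : ℂ⟦X⟧} (hh : coeff 0 h = 1) {n : ℤ} {k : ℕ}
    (hn : 𝒱.minWeight + k ≤ n) {u : V} (hu : u ∈ 𝒱.filtration k)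
    (heq : 𝒱.fieldRep h u = (n : ℂ) • u) : u = 0 := by
  induction k with
  | zero => exact 𝒱.eq_zero_of_mem_filtration rfl hu
  | succ k ih =>
    refine ih (by omega) ?_
    have h1 : 𝒱.fieldRep (h - 1) u ∈ 𝒱.filtration k :=
      𝒱.lowers_fieldRep (m := 1) (by
        rw [pow_one, X_dvd_iff, ← coeff_zero_eq_constantCoeff_apply, map_sub, hh, coeff_zero_one,
          sub_self]) (k + 1) u hu
    -- On the top piece L(0) is the scalar `minWeight` + k, so u times n minus this scalar drops one
    -- level.
    have h2 : (𝒱.L 0 - ((𝒱.minWeight + k : ℤ) : ℂ) • 1 : Module.End ℂ V) u ∈ 𝒱.filtration k := by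
      refine 𝒱.mem_filtration_of_forall_eigen (fun m hm v hv => ?_) hu
      rw [LinearMap.sub_apply, LinearMap.smul_apply, Module.End.one_apply, 𝒱.mem_eigen.mp hv,
        ← sub_smul]
      rcases eq_or_ne m (𝒱.minWeight + k) with rfl | hne
      · rw [sub_self, zero_smul]
        exact zero_mem _
      · exact Submodule.smul_mem _ _ (𝒱.eigen_le_filtration (by omega) hv)
    rw [map_sub, LinearMap.sub_apply, heq, fieldRep_one] at h1
    have h3 := add_mem h1 h2
    rw [LinearMap.sub_apply, LinearMap.smul_apply, Module.End.one_apply, sub_add_sub_cancel,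
      ← sub_smul] at h3
    refine (Submodule.smul_mem_iff _ ?_).mp h3
    rw [sub_ne_zero]
    exact_mod_cast (by omega : n ≠ 𝒱.minWeight + k)

theorem neg_smul_L_eq (b : ℂ) (j : ℕ) : -b • 𝒱.L j = -𝒱.fieldRep (b • X ^ j) := by
  rw [map_smul, fieldRep_X_pow, neg_smul]

/-- The product of the first `N` factors of `⋯ exp(-b 2 L(2)) exp(-b 1 L(1))`. -/
noncomputable def prodEnd (b : ℕ+ → ℂ) : ℕ → Module.End ℂ V
  | 0 => 1
  | N + 1 => (𝒱.lowers_neg_fieldRep (X_dvd_smul_X_pow (b N.succPNat) N.succPNat)).exp * prodEnd b N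

theorem prodEnd_apply (b : ℕ+ → ℂ) (N : ℕ) (v : V) :
    𝒱.prodEnd b N v = partialProduct (fun j : ℕ+ => expEnd (-(b j) • 𝒱.L j)) N v := by
  induction N with
  | zero => rfl
  | succ N ih =>
    change expEnd _ (𝒱.prodEnd b N v) = expEnd _ _
    rw [ih, ← neg_smul_L_eq]

theorem lowers_prodEnd_sub_one (b : ℕ+ → ℂ) (N : ℕ) : 𝒱.Lowers 1 (𝒱.prodEnd b N - 1) := by
  induction N with
  | zero => exact fun k v _ => by simp [prodEnd]
  | succ N ih =>
    intro k v hv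
    have h1 := (𝒱.lowers_neg_fieldRep (X_dvd_smul_X_pow (b N.succPNat) N.succPNat)).exp_sub_one k _
      (mem_filtration_of_lowers_sub_one ih hv)
    have h2 := add_mem h1 (ih k v hv)
    simpa [prodEnd] using h2

theorem prodEnd_L_zero (b : ℕ+ → ℂ) (N : ℕ) (v : V) :
    𝒱.prodEnd b N (𝒱.L 0 v) = 𝒱.fieldRep (prodAd b N) (𝒱.prodEnd b N v) := by
  induction N with
  | zero =>
    change 𝒱.L 0 v = 𝒱.fieldRep 1 v
    rw [fieldRep_one]
  | succ N ih =>
    change expEnd _ (𝒱.prodEnd b N (𝒱.L 0 v)) = 𝒱.fieldRep _ (expEnd _ (𝒱.prodEnd b N v))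
    rw [ih]
    exact 𝒱.expEnd_fieldRep (X_dvd_smul_X_pow (b N.succPNat) N.succPNat) _ _

theorem eventually_prodEnd_eq {f : ℂ⟦X⟧} (hf0 : coeff 0 f = 0) (hf1 : coeff 1 f = 1)
    {b A : ℕ+ → ℂ} (hb : IsProductDecomposition f b) (hA : IsExponentialForm f A) (v : V) :
    ∀ᶠ N : ℕ in atTop,
      𝒱.prodEnd b N v = (𝒱.lowers_neg_fieldRep (X_dvd_fieldSeries A)).exp v := by
  have hT := 𝒱.lowers_neg_fieldRep (X_dvd_fieldSeries A)
  have hv : v ∈ ⨆ n, 𝒱.eigen n := by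
    rw [iSup_eigen]
    trivial
  induction hv using Submodule.iSup_induction' with
  | zero => exact Eventually.of_forall fun N => by rw [map_zero, map_zero]
  | add x y _ _ hx hy =>
    filter_upwards [hx, hy] with N hNx hNy
    rw [map_add, map_add, hNx, hNy]
  | mem n v hv =>
    rcases lt_or_ge n 𝒱.minWeight with hn | hn
    · rw [𝒱.eigen_eq_bot_of_lt hn, Submodule.mem_bot] at hv
      exact Eventually.of_forall fun N => by rw [hv, map_zero, map_zero]
    obtain ⟨k, rfl⟩ : ∃ k : ℕ, n = 𝒱.minWeight + k := ⟨(n - 𝒱.minWeight).toNat, by omega⟩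
    have hvk : v ∈ 𝒱.filtration (k + 1) := 𝒱.eigen_le_filtration (by omega) hv
    filter_upwards [eventually_X_pow_dvd_prodAd_sub hf0 hf1 hb hA (k + 1)] with N hN
    rw [← sub_eq_zero]
    -- Both images are v modulo level k, so their difference lies strictly below the weight of v.
    refine 𝒱.eq_zero_of_fieldRep_eq_smul (k := k) (n := 𝒱.minWeight + k)
      (h := expSeries (adOp (fieldSeries A)) 1)
      (by rw [coeff_zero_expSeries_adOp (X_dvd_fieldSeries A), coeff_zero_one]) le_rfl ?_ ?_
    · have h1 := sub_mem (𝒱.lowers_prodEnd_sub_one b N (k + 1) v hvk)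
        (hT.exp_sub_one (k + 1) v hvk)
      simpa using h1
    · have h1 := 𝒱.prodEnd_L_zero b N v
      have h2 := 𝒱.expEnd_fieldRep (X_dvd_fieldSeries A) 1 v
      rw [fieldRep_one, ← hT.exp_apply, ← hT.exp_apply] at h2
      rw [𝒱.fieldRep_eq_of_X_pow_dvd_sub hN
        (mem_filtration_of_lowers_sub_one (𝒱.lowers_prodEnd_sub_one b N) hvk)] at h1
      rw [map_sub, ← h1, ← h2, 𝒱.mem_eigen.mp hv, map_smul, map_smul, smul_sub]

end VertexOperatorAlgebra

/-- For a formal change of variable `f(x) = x + ∑ n ≥ 2, a_n x^n`, the sequences `b` and `A` with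
`f(x) = ⋯ exp(b 2 x^3 d/dx) exp(b 1 x^2 d/dx) · x` and `f(x) = exp(∑ j, A j x^(j+1) d/dx) · x` exist
and are unique, and on any vertex operator algebra the infinite product
`⋯ exp(-b 3 L(3)) exp(-b 2 L(2)) exp(-b 1 L(1))` and `exp(-∑ j, A j L(j))` are well defined and are
the same linear automorphism. -/
theorem mainTheorem1 {V : Type*} [AddCommGroup V] [Module ℂ V] (𝒱 : VertexOperatorAlgebra V)
    (f : PowerSeries ℂ) (hf0 : PowerSeries.coeff 0 f = 0) (hf1 : PowerSeries.coeff 1 f = 1) :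
    (∃! b : ℕ+ → ℂ, IsProductDecomposition f b) ∧
    (∃! A : ℕ+ → ℂ, IsExponentialForm f A) ∧
    ∀ b A : ℕ+ → ℂ, IsProductDecomposition f b → IsExponentialForm f A →
      (∀ j : ℕ+, IsLocallyNilpotent (𝒱.L j)) ∧
      IsLocallyNilpotent (𝒱.sumL A) ∧
      ∃ Φ : V ≃ₗ[ℂ] V,
        (∀ v : V, Φ v = expEnd (-𝒱.sumL A) v) ∧
        (∀ v : V, ∀ᶠ N : ℕ in Filter.atTop,
          partialProduct (fun j : ℕ+ => expEnd (-(b j) • 𝒱.L j)) N v = Φ v) := by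
  refine ⟨existsUnique_isProductDecomposition hf0 hf1, existsUnique_isExponentialForm hf0 hf1,
    fun b A hb hA => ⟨fun j => ?_, ?_, ?_⟩⟩
  · exact ((𝒱.lowers_L j).mono (PNat.pos j)).isLocallyNilpotent
  · rw [𝒱.sumL_eq_fieldRep]
    exact (𝒱.lowers_fieldRep (m := 1)
      (by simpa using X_dvd_fieldSeries A)).isLocallyNilpotent
  · have hT := 𝒱.lowers_neg_fieldRep (X_dvd_fieldSeries A)
    refine ⟨LinearEquiv.ofBijective hT.exp
      (VertexOperatorAlgebra.bijective_of_lowers_sub_one hT.exp_sub_one), fun v => ?_, fun v => ?_⟩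
    · rw [𝒱.sumL_eq_fieldRep]
      rfl
    · filter_upwards [𝒱.eventually_prodEnd_eq hf0 hf1 hb hA v] with N hN
      rw [← 𝒱.prodEnd_apply, hN]
      rfl
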